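/- Let $G$ be a non-solvable generalized Baumslag--Solitar (GBS) group, i.e. a non-solvable group isomorphic to the fundamental group of a finite graph of groups all of whose vertex and edge groups are infinite cyclic. A $G$-tree is a metric simplicial tree (identified with its geometric realization) with an action of $G$ by simplicial isometries without inversions. Let $\mathcal D$ be the cyclic deformation space of $G$: the set of minimal $G$-trees whose vertex and edge stabilizers are infinite cyclic, up to $G$-equivariant isometry or homothety. For such trees let $\operatorname{Lip}(X,Y)$ be the infimum of the Lipschitz constants of the $G$-equivariant Lipschitz maps $X\to Y$, let $\operatorname{vol}(X/G)$ be the sum of the lengths of the edges of $X/G$, and let $$d_{\mathrm{Lip}}(X,Y)=\log\left(\operatorname{Lip}(X,Y)\,\frac{\operatorname{vol}(X/G)}{\operatorname{vol}(Y/G)}\right),$$ which depends only on the classes of $X$ and $Y$ in $\mathcal D$. The automorphism group of $G$ acts on $\mathcal D$ on the right by precomposing the actions on trees, and this induces an action of $\operatorname{Out}(G)$. The axes topology on $\mathcal D$ is the quotient of the coarsest topology on trees for which all translation length functions $X\mapsto\|g\|_X$, $g\in G$, are continuous. A cyclic factor of $G$ is a subgroup conjugate to the fundamental group of a connected subgraph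 of a finite graph of infinite cyclic groups whose fundamental group is identified with $G$. An element $\phi\in\operatorname{Out}(G)$ is fully irreducible if no power $\phi^n$, $n\ge 1$, preserves the conjugacy class of a proper cyclic factor which is not elliptic (fixes no point in trees of $\mathcal D$). A train track representative of $\phi$, with stretch factor $\lambda$, is a map $f:T\to T$, $T\in\mathcal D$, which is equivariant with respect to some automorphism in the class $\phi$, sends vertices to vertices, is linear on edges (mapping each edge to a non-degenerate non-backtracking path) with the same Lipschitz constant $\lambda$ on all edges, and is such that, for the gate structure induced by $f$ (the smallest $G$-invariant family of equivalence relations on the sets of edges with a common origin that identifies $e$ and $e'$ whenever $f(e)\cap f(e')$ has non-zero length), there are at least two gates at every vertex and, for every edge $e$ and every $k\in\mathbb N$, the path $f^k(e)$ crosses only legal turns, i.e. pairs of edges in different gates. An axis for $\phi$ crossing $T$ is a map $\mathcal L:\mathbb R\to\mathcal D$, $t\mapsto T_t$, continuous for the axes topology, with $d_{\mathrm{Lip}}(T_s,T_t)=t-s$ for all $s<t$, with $T_0=T$, and such that $T\cdot\phi^n$ lies on $\mathcal L$ for every $n\in\mathbb Z$. **Lemma.** Let $\phi\in\operatorname{Out}(G)$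 be fully irreducible, let $f:T\to T$ be a train track representative of $\phi$ with stretch factor $\lambda>1$, and let $f_-:T_-\to T_-$ be a train track representative of $\phi^{-1}$ with stretch factor $\lambda_->1$. Let $\mathcal L_f:t\mapsto T_t$ be an axis for $\phi$ crossing $T$ and $\mathcal L_{f_-}:t\mapsto (T_-)_t$ an axis for $\phi^{-1}$ crossing $T_-$. Let $a<b$, $c$, $d$ be real numbers. There is a constant $D>1$ such that for all $$X,Y\in\{T_t : a\le t\le b\}\cup\{(T_-)_t : c\le t\le d\},$$ represented by trees normalized so that $\operatorname{vol}(X/G)=\operatorname{vol}(Y/G)=1$, we have $\operatorname{Lip}(X,Y)\le D$. -/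

import Mathlib

open Set
open scoped NNReal ENNReal

universe u

/-! ### Graphs of infinite cyclic groups and generalized Baumslag-Solitar groups -/

/-- A finite graph of infinite cyclic groups. Edges are oriented, `rev` is the fixed point free
involution reversing the orientation, `init e` is the initial vertex of `e`. A generator of each
vertex group and of each edge group is chosen (the same for `e` and `rev e`), so that the inclusion
of the group of `e` into the group of the terminal vertex of `e` is multiplication by the non-zero
integer `label e`. -/
structure CyclicGraph where
  V : Type
  E : Type
  finite_V : Finite V
  finite_E : Finite E
  rev : E → E
  rev_rev : ∀ e, rev (rev e) = e
  rev_ne : ∀ e, rev e ≠ e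
  init : E → V
  label : E → ℤ
  label_ne : ∀ e, label e ≠ 0

namespace CyclicGraph

variable (Γ : CyclicGraph)

/-- The terminal vertex of an edge. -/
def term (e : Γ.E) : Γ.V := Γ.init (Γ.rev e)

/-- Non-backtracking edge paths. -/
def IsReduced (p : List Γ.E) : Prop :=
  p.IsChain (fun e e' => Γ.term e = Γ.init e' ∧ e' ≠ Γ.rev e)

/-- `(W, F)` is a non-empty connected subgraph. -/
structure IsConnectedSubgraph (W : Set Γ.V) (F : Set Γ.E) : Prop where
  nonempty : W.Nonempty
  rev_mem : ∀ e ∈ F, Γ.rev e ∈ F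
  init_mem : ∀ e ∈ F, Γ.init e ∈ W
  connected : ∀ v ∈ W, ∀ w ∈ W,
    Relation.ReflTransGen (fun x y => ∃ e ∈ F, Γ.init e = x ∧ Γ.term e = y) v w

/-- `(W, F)` is a subtree: a connected subgraph without non-backtracking loops. -/
structure IsSubtree (W : Set Γ.V) (F : Set Γ.E) : Prop extends Γ.IsConnectedSubgraph W F where
  no_loop : ∀ (p : List Γ.E) (hp : p ≠ []), (∀ e ∈ p, e ∈ F) → Γ.IsReduced p →
    Γ.init (p.head hp) ≠ Γ.term (p.getLast hp)

/-- The relations of the fundamental group; the generators are the chosen generators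
`Sum.inl v` of the vertex groups and the stable letters `Sum.inr e`. The element `h` of an edge
group is the `k`-th power of its generator. -/
def rels (τ : Set Γ.E) : Set (FreeGroup (Γ.V ⊕ Γ.E)) :=
  {r | ∃ (e : Γ.E) (k : ℤ),
      r = FreeGroup.of (Sum.inr e) * FreeGroup.of (Sum.inl (Γ.term e)) ^ (Γ.label e * k) *
        FreeGroup.of (Sum.inr (Γ.rev e)) *
        (FreeGroup.of (Sum.inl (Γ.init e)) ^ (Γ.label (Γ.rev e) * k))⁻¹} ∪
  {r | ∃ e ∈ τ, r = FreeGroup.of (Sum.inr e)}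

/-- The fundamental group of the graph of groups relative to a maximal subtree `τ`. -/
abbrev π₁ (τ : Set Γ.E) : Type := PresentedGroup (Γ.rels τ)

/-- The subgroup of the fundamental group carried by a subgraph `(W, F)`. -/
def subgraphGroup (τ : Set Γ.E) (W : Set Γ.V) (F : Set Γ.E) : Subgroup (Γ.π₁ τ) :=
  Subgroup.closure
    ((fun x => (PresentedGroup.of x : Γ.π₁ τ)) '' (Sum.inl '' W ∪ Sum.inr '' F))

end CyclicGraph

/-- Generalized Baumslag-Solitar groups. -/
def IsGBS (G : Type u) [Group G] : Prop :=
  ∃ (Γ : CyclicGraph) (τ : Set Γ.E), Γ.IsSubtree univ τ ∧ Nonempty (G ≃* Γ.π₁ τ)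

/-- `H` is a cyclic factor: up to conjugacy it is the fundamental group of a connected subgraph
`(W, F)` of a graph of cyclic groups with fundamental group `G`. The maximal subtree `τ` is chosen
so that it restricts to a maximal subtree of the subgraph. -/
def IsCyclicFactor {G : Type u} [Group G] (H : Subgroup G) : Prop :=
  ∃ (Γ : CyclicGraph) (τ : Set Γ.E) (Ψ : G ≃* Γ.π₁ τ) (W : Set Γ.V) (F : Set Γ.E) (g : G),
    Γ.IsSubtree univ τ ∧ Γ.IsConnectedSubgraph W F ∧ Γ.IsSubtree W (τ ∩ F) ∧
    (H.map (MulAut.conj g).toMonoidHom).map Ψ.toMonoidHom = Γ.subgraphGroup τ W F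

/-! ### Metric simplicial trees with an isometric action -/

/-- The segment between two points of a metric space (the geodesic `[x, y]` in a tree). -/
def seg {X : Type u} [MetricSpace X] (x y : X) : Set X :=
  {z | dist x z + dist z y = dist x y}

/-- `v, w` are the end points of an edge, for the set of vertices `V`. -/
def IsEdge {X : Type u} [MetricSpace X] (V : Set X) (v w : X) : Prop :=
  v ∈ V ∧ w ∈ V ∧ v ≠ w ∧ seg v w ∩ V = {v, w}

/-- A `G`-tree: a metric simplicial tree with an action of `G` by simplicial isometries, without
inversions. The tree is identified with its geometric realization `carrier`, a geodesic
`0`-hyperbolic metric space, which is the union of the vertices and of the edges; a segment contains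
finitely many vertices, and one can leave an edge only through its end points. -/
structure GTree (G : Type u) [Group G] where
  carrier : Type u
  [metric : MetricSpace carrier]
  [action : MulAction G carrier]
  [isometric : IsIsometricSMul G carrier]
  geodesic : ∀ x y : carrier, ∃ γ : ℝ → carrier, γ 0 = x ∧ γ (dist x y) = y ∧
    ∀ s ∈ Icc 0 (dist x y), ∀ t ∈ Icc 0 (dist x y), dist (γ s) (γ t) = |s - t|
  hyperbolic : ∀ x y z w : carrier,
    dist x y + dist z w ≤ max (dist x z + dist y w) (dist x w + dist y z)
  vert : Set carrier
  vert_nonempty : vert.Nonempty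
  vert_finite : ∀ x y : carrier, (seg x y ∩ vert).Finite
  cover : ∀ x : carrier, x ∈ vert ∨ ∃ v w, IsEdge vert v w ∧ x ∈ seg v w
  leave_edge : ∀ v w x y : carrier, IsEdge vert v w → x ∈ seg v w → y ∉ seg v w →
    v ∈ seg x y ∨ w ∈ seg x y
  smul_vert : ∀ (g : G), ∀ v ∈ vert, g • v ∈ vert
  no_inversion : ∀ (g : G) (v w : carrier), IsEdge vert v w → g • v = w → g • w ≠ v

attribute [instance] GTree.metric GTree.action GTree.isometric

namespace GTree

variable {G : Type u} [Group G]

/-- No proper non-empty `G`-invariant subtree. -/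
def IsMinimal (T : GTree G) : Prop :=
  ∀ Y : Set T.carrier, Y.Nonempty → (∀ x ∈ Y, ∀ y ∈ Y, seg x y ⊆ Y) →
    (∀ g : G, ∀ x ∈ Y, g • x ∈ Y) → Y = univ

/-- All vertex and edge stabilizers are infinite cyclic. -/
def HasCyclicStabilizers (T : GTree G) : Prop :=
  (∀ v ∈ T.vert, IsCyclic (MulAction.stabilizer G v) ∧ Infinite (MulAction.stabilizer G v)) ∧
  (∀ v w, IsEdge T.vert v w →
    IsCyclic ↥(MulAction.stabilizer G v ⊓ MulAction.stabilizer G w) ∧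
    Infinite ↥(MulAction.stabilizer G v ⊓ MulAction.stabilizer G w))

/-- The action precomposed with an automorphism of `G`. -/
def twist (T : GTree G) (φ : MulAut G) : GTree G :=
  letI a : MulAction G T.carrier := MulAction.compHom T.carrier φ.toMonoidHom
  { carrier := T.carrier
    metric := T.metric
    action := a
    isometric := ⟨fun g => isometry_smul T.carrier (φ g)⟩
    geodesic := T.geodesic
    hyperbolic := T.hyperbolic
    vert := T.vert
    vert_nonempty := T.vert_nonempty
    vert_finite := T.vert_finite
    cover := T.cover
    leave_edge := T.leave_edge
    smul_vert := fun g => T.smul_vert (φ g)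
    no_inversion := fun g => T.no_inversion (φ g) }

theorem isEdge_smul (T : GTree G) (g : G) {v w : T.carrier} (h : IsEdge T.vert v w) :
    IsEdge T.vert (g • v) (g • w) := by
  obtain ⟨hv, hw, hne, hs⟩ := h
  refine ⟨T.smul_vert g v hv, T.smul_vert g w hw, fun h => hne (smul_left_cancel g h), ?_⟩
  have key : ∀ z, z ∈ seg (g • v) (g • w) ∩ T.vert ↔ g⁻¹ • z ∈ seg v w ∩ T.vert := by
    intro z
    have h1 : dist (g • v) z = dist v (g⁻¹ • z) := by
      rw [← dist_smul g v (g⁻¹ • z), smul_inv_smul]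
    have h2 : dist z (g • w) = dist (g⁻¹ • z) w := by
      rw [← dist_smul g (g⁻¹ • z) w, smul_inv_smul]
    have h3 : z ∈ T.vert ↔ g⁻¹ • z ∈ T.vert :=
      ⟨T.smul_vert g⁻¹ z, fun h => by simpa using T.smul_vert g _ h⟩
    simp only [mem_inter_iff, seg, mem_ofPred_eq, h1, h2, h3, dist_smul]
  ext z
  rw [key, hs]
  simp only [mem_insert_iff, mem_singleton_iff, inv_smul_eq_iff]

/-- The oriented edges. -/
def OrientedEdge (T : GTree G) : Type u :=
  {p : T.carrier × T.carrier // IsEdge T.vert p.1 p.2}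

instance (T : GTree G) : MulAction G T.OrientedEdge where
  smul g e := ⟨(g • e.1.1, g • e.1.2), T.isEdge_smul g e.2⟩
  one_smul e := Subtype.ext (Prod.ext (one_smul G e.1.1) (one_smul G e.1.2))
  mul_smul g h e := Subtype.ext (Prod.ext (mul_smul g h e.1.1) (mul_smul g h e.1.2))

/-- The length of an oriented edge of the quotient graph. -/
noncomputable def quotientLength (T : GTree G) :
    MulAction.orbitRel.Quotient G T.OrientedEdge → ℝ :=
  Quotient.lift (fun e : T.OrientedEdge => dist e.1.1 e.1.2) (by
    rintro e e' ⟨g, rfl⟩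
    exact dist_smul g e'.1.1 e'.1.2)

/-- The volume of the quotient graph: the sum of the lengths of its edges, each of which carries two
orientations. -/
noncomputable def covolume (T : GTree G) : ℝ≥0∞ :=
  (∑' o : MulAction.orbitRel.Quotient G T.OrientedEdge, ENNReal.ofReal (T.quotientLength o)) / 2

/-- The translation length of an element of `G`. -/
noncomputable def translationLength (T : GTree G) (g : G) : ℝ := ⨅ x : T.carrier, dist x (g • x)

/-- The infimum of the Lipschitz constants of the equivariant Lipschitz maps `T → T'` (the value is
`∞` if there is none). -/
noncomputable def lip (T T' : GTree G) : ℝ≥0∞ :=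
  ⨅ (K : ℝ≥0) (_ : ∃ f : T.carrier → T'.carrier,
    (∀ (g : G) (x : T.carrier), f (g • x) = g • f x) ∧ LipschitzWith K f), (K : ℝ≥0∞)

/-- The Lipschitz metric; it is unchanged when `T` or `T'` is rescaled. -/
noncomputable def dLip (T T' : GTree G) : EReal :=
  ENNReal.log (T.lip T' * (T.covolume / T'.covolume))

/-- There is a `G`-equivariant isometry or homothety from `T` to `T'`. -/
def Homothetic (T T' : GTree G) : Prop :=
  ∃ (h : T.carrier ≃ T'.carrier) (c : ℝ), 0 < c ∧
    (∀ (g : G) (x : T.carrier), h (g • x) = g • h x) ∧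
    ∀ x y : T.carrier, dist (h x) (h y) = c * dist x y

end GTree

/-! ### The cyclic deformation space -/

/-- The minimal simplicial `G`-trees with cyclic vertex and edge stabilizers. -/
structure CyclicTree (G : Type u) [Group G] extends GTree G where
  minimal : toGTree.IsMinimal
  cyclic : toGTree.HasCyclicStabilizers

namespace CyclicTree

variable {G : Type u} [Group G]

instance homothetySetoid : Setoid (CyclicTree G) where
  r T T' := T.toGTree.Homothetic T'.toGTree
  iseqv :=
    { refl := fun T => ⟨Equiv.refl _, 1, one_pos, fun _ _ => rfl, fun _ _ => (one_mul _).symm⟩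
      symm := by
        rintro T T' ⟨h, c, hc, he, hd⟩
        refine ⟨h.symm, c⁻¹, inv_pos.mpr hc, fun g x => ?_, fun x y => ?_⟩
        · rw [Equiv.symm_apply_eq, he, Equiv.apply_symm_apply]
        · rw [eq_inv_mul_iff_mul_eq₀ hc.ne', ← hd, Equiv.apply_symm_apply,
            Equiv.apply_symm_apply]
      trans := by
        rintro T T' T'' ⟨h, c, hc, he, hd⟩ ⟨h', c', hc', he', hd'⟩
        refine ⟨h.trans h', c' * c, mul_pos hc' hc, fun g x => ?_, fun x y => ?_⟩
        · simp only [Equiv.trans_apply, he, he']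
        · simp only [Equiv.trans_apply, hd, hd', mul_assoc] }

/-- The axes topology: the coarsest one for which translation lengths are continuous. -/
noncomputable instance axesTopology : TopologicalSpace (CyclicTree G) :=
  TopologicalSpace.induced (fun T (g : G) => T.translationLength g) inferInstance

/-- The right action of `Aut(G)` on trees. -/
def twist (T : CyclicTree G) (φ : MulAut G) : CyclicTree G where
  toGTree := T.toGTree.twist φ
  minimal := by
    intro Y hY hc hi
    refine T.minimal Y hY hc fun g x hx => ?_
    have h : φ (φ.symm g) • x ∈ Y := hi (φ.symm g) x hx
    rwa [MulEquiv.apply_symm_apply] at h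
  cyclic := by
    have tr : ∀ H K : Subgroup G, (∀ g, g ∈ H ↔ φ g ∈ K) → IsCyclic K ∧ Infinite K →
        IsCyclic H ∧ Infinite H := by
      rintro H K hHK ⟨h1, h2⟩
      have hK : H = K.comap φ.toMonoidHom := by
        ext g
        exact hHK g
      have e : H ≃* K :=
        { toFun := fun g => ⟨φ g, (hHK g).mp g.2⟩
          invFun := fun k => ⟨φ.symm k, (hHK _).mpr (by simp)⟩
          left_inv := fun g => Subtype.ext (by simp)
          right_inv := fun k => Subtype.ext (by simp)
          map_mul' := fun a b => Subtype.ext (by simp) }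
      exact ⟨e.symm.isCyclic.mp h1, e.toEquiv.infinite_iff.mpr h2⟩
    refine ⟨fun v hv => ?_, fun v w h => ?_⟩
    · exact tr _ (MulAction.stabilizer G (α := T.carrier) v) (fun _ => Iff.rfl) (T.cyclic.1 v hv)
    · exact tr _ (MulAction.stabilizer G (α := T.carrier) v ⊓
        MulAction.stabilizer G (α := T.carrier) w) (fun _ => Iff.rfl) (T.cyclic.2 v w h)

end CyclicTree

/-- The cyclic deformation space, with the axes topology: trees up to equivariant isometry or
homothety. -/
abbrev DeformationSpace (G : Type u) [Group G] := 
  Quotient (CyclicTree.homothetySetoid (G := G))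

/-! ### Outer automorphisms, full irreducibility -/

instance conjRangeNormal (G : Type u) [Group G] :
    ((MulAut.conj : G →* MulAut G).range).Normal where
  conj_mem := by
    rintro _ ⟨g, rfl⟩ φ
    exact ⟨φ g, MulEquiv.ext fun x => by simp [MulAut.conj_apply, MulAut.mul_apply]⟩

/-- The outer automorphism group. -/
abbrev Out (G : Type u) [Group G] := MulAut G ⧸ (MulAut.conj : G →* MulAut G).range

/-- The subgroup `H` fixes a point in some tree of the deformation space. -/
def IsElliptic {G : Type u} [Group G] (H : Subgroup G) : Prop :=
  ∃ (T : CyclicTree G) (x : T.carrier), ∀ h ∈ H, h • x = x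

/-- No (non-trivial) power of `Φ` preserves the conjugacy class of a proper non-elliptic cyclic
factor. -/
def FullyIrreducible {G : Type u} [Group G] (Φ : Out G) : Prop :=
  ∀ (n : ℕ) (φ : MulAut G), 0 < n → (QuotientGroup.mk φ : Out G) = Φ ^ n →
    ∀ H : Subgroup G, IsCyclicFactor H → H ≠ ⊤ → ¬ IsElliptic H →
      ∀ g : G, H.map φ.toMonoidHom ≠ H.map (MulAut.conj g).toMonoidHom

/-! ### Train track representatives -/

namespace GTree

variable {G : Type u} [Group G]

/-- A gate structure: a `G`-invariant family of equivalence relations on the edges with origin `v`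
(an edge with origin `v` is given by its other end point). -/
structure GateStructure (T : GTree G) where
  rel : T.carrier → T.carrier → T.carrier → Prop
  refl : ∀ v e, IsEdge T.vert v e → rel v e e
  symm : ∀ v e e', IsEdge T.vert v e → IsEdge T.vert v e' → rel v e e' → rel v e' e
  trans : ∀ v e e' e'', IsEdge T.vert v e → IsEdge T.vert v e' → IsEdge T.vert v e'' →
    rel v e e' → rel v e' e'' → rel v e e''
  smul : ∀ (g : G) (v e e' : T.carrier), IsEdge T.vert v e → IsEdge T.vert v e' →
    rel v e e' → rel (g • v) (g • e) (g • e')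

/-- The edges `[v, e]` and `[v, e']` are equivalent for the minimal gate structure that identifies
edges with common origin whose images under `f` overlap, so that the turn they form is illegal for
the gate structure induced by `f`. The images are segments with a common end point, so they overlap
in positive length as soon as they share a second point. -/
def SameGate (T : GTree G) (f : T.carrier → T.carrier) (v e e' : T.carrier) : Prop :=
  ∀ R : T.GateStructure,
    (∀ v e e', IsEdge T.vert v e → IsEdge T.vert v e' →
      (f '' seg v e ∩ f '' seg v e').Nontrivial → R.rel v e e') →
    R.rel v e e'

/-- The path `p`, restricted to the segment `[v, w]`, crosses the turn formed by the edges `[u, e]`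
and `[u, e']`. -/
def CrossesTurn (T : GTree G) (p : T.carrier → T.carrier) (v w u e e' : T.carrier) : Prop :=
  IsEdge T.vert u e ∧ IsEdge T.vert u e' ∧
  ∃ x ∈ seg v w, p x = u ∧
    (∃ y ∈ seg v x, p y ≠ u ∧ p '' seg y x ⊆ seg u e) ∧
    (∃ y ∈ seg x w, p y ≠ u ∧ p '' seg x y ⊆ seg u e')

end GTree

/-- `f : T → T` is a train track representative for `Φ`, linear on edges with the same Lipschitz
constant `lam` on all of them. -/
structure IsTrainTrack {G : Type u} [Group G] (Φ : Out G) (T : CyclicTree G)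
    (f : T.carrier → T.carrier) (lam : ℝ) : Prop where
  equivariant : ∃ φ : MulAut G, (QuotientGroup.mk φ : Out G) = Φ ∧
    ∀ (g : G) (x : T.carrier), f (g • x) = φ g • f x
  map_vert : ∀ v ∈ T.vert, f v ∈ T.vert
  linear : ∀ v w, IsEdge T.vert v w → ∀ x ∈ seg v w, ∀ y ∈ seg v w,
    dist (f x) (f y) = lam * dist x y
  length_pos : ∀ v w, IsEdge T.vert v w → 0 < dist (f v) (f w)
  two_gates : ∀ v ∈ T.vert, ∃ e e', IsEdge T.vert v e ∧ IsEdge T.vert v e' ∧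
    ¬ T.SameGate f v e e'
  legal : ∀ v w, IsEdge T.vert v w → ∀ (k : ℕ) (u e e' : T.carrier),
    T.CrossesTurn (f^[k]) v w u e e' → ¬ T.SameGate f u e e'

/-! ### Axes -/

/-- Geodesics for the Lipschitz metric. As this metric depends only on the homothety classes of
the trees, all representatives of the points of `L` may be used. -/
def IsLipGeodesic {G : Type u} [Group G] (L : ℝ → DeformationSpace G) : Prop :=
  ∀ s t : ℝ, s < t → ∀ X Y : CyclicTree G, ⟦X⟧ = L s → ⟦Y⟧ = L t →
    X.toGTree.dLip Y.toGTree = ((t - s : ℝ) : EReal)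

/-- `L` is an axis for `Φ` crossing `T`: a geodesic, continuous for the axes topology, which
contains all the points `T · Φⁿ`, parametrized so that `T` has parameter `0`. -/
structure IsAxis {G : Type u} [Group G] (Φ : Out G) (T : CyclicTree G)
    (L : ℝ → DeformationSpace G) : Prop where
  continuous : Continuous L
  geodesic : IsLipGeodesic L
  zero : L 0 = ⟦T⟧
  orbit : ∀ n : ℤ, ∃ φ : MulAut G, (QuotientGroup.mk φ : Out G) = Φ ^ n ∧
    ∃ t : ℝ, L t = ⟦T.twist φ⟧

/-! ### Segments of trees -/

/-! The bound passes through two fixed trees. Let X sit on a geodesic `L` at a parameter in [a, b],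
and let Y sit on a geodesic `M` at a parameter in [c, d]. Fix a tree A representing `L (b + 1)` and
a tree B representing `M (c - 1)`. The geodesic equation computes Lip(X, A) and Lip(B, Y) exactly,
and for volume-one X and Y it bounds them by exp(b + 1 - a) vol(A) and exp(d - c + 1) / vol(B).
Since Lip is submultiplicative, one equivariant Lipschitz map A → B bounds Lip(X, Y) uniformly.
Applying this to the four choices of source and target piece gives D.

The map A → B (`exists_lipschitz`) exists because both trees lie in the same deformation space. A
vertex group ⟨h⟩ of A is commensurable with all its conjugates
(`HasCyclicStabilizers.exists_pow_mem_stabilizer`). If h had no fixed point in B, its axis would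
therefore be G-invariant, hence all of B by minimality; a group acting on a line with a cyclic point
stabilizer is solvable (`isSolvable_of_isometry_real`), a contradiction. So vertices of A can be
sent equivariantly to points of B, and the map extended linearly over edges. It is Lipschitz because
there are finitely many edge orbits (`exists_finite_edge_representatives`). -/

theorem mem_seg {X : Type u} [MetricSpace X] {x y z : X} :
    z ∈ seg x y ↔ dist x z + dist z y = dist x y := Iff.rfl

theorem seg_comm {X : Type u} [MetricSpace X] (x y : X) : seg x y = seg y x := by
  ext z
  rw [mem_seg, mem_seg, dist_comm x z, dist_comm z y, dist_comm x y, add_comm]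

theorem left_mem_seg {X : Type u} [MetricSpace X] (x y : X) : x ∈ seg x y := by simp [mem_seg]

theorem right_mem_seg {X : Type u} [MetricSpace X] (x y : X) : y ∈ seg x y := by simp [mem_seg]

theorem mem_seg_of_mem_seg_left {X : Type u} [MetricSpace X] {x y z w : X} (hz : z ∈ seg x y)
    (hw : w ∈ seg x z) : w ∈ seg x y := by
  rw [mem_seg] at *
  have h1 := dist_triangle w z y
  have h2 := dist_triangle x w y
  linarith

theorem IsEdge.symm {X : Type u} [MetricSpace X] {V : Set X} {v w : X} (h : IsEdge V v w) :
    IsEdge V w v := by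
  obtain ⟨hv, hw, hne, hs⟩ := h
  exact ⟨hw, hv, hne.symm, by rw [seg_comm, hs, pair_comm]⟩

namespace GTree

variable {G : Type u} [Group G] (T : GTree G)

theorem four_point (x y z w : T.carrier) :
    dist x y + dist z w ≤ dist x z + dist y w ∨ dist x y + dist z w ≤ dist x w + dist y z :=
  le_max_iff.mp (T.hyperbolic x y z w)

variable {T}

/-- Triangles in a tree are tripods. -/
theorem mem_seg_or_mem_seg {a c z : T.carrier} (hz : z ∈ seg a c) (b : T.carrier) :
    z ∈ seg a b ∨ z ∈ seg b c := by
  simp only [mem_seg] at *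
  have h1 := dist_triangle a z b
  have h2 := dist_triangle b z c
  have := dist_comm b z
  rcases T.four_point a c b z with h | h
  · left
    have := dist_comm c z
    linarith
  · right
    have := dist_comm c b
    linarith

theorem dist_eq_of_mem_seg {u v p q : T.carrier} (hp : p ∈ seg u v) (hq : q ∈ seg u v) :
    dist p q = |dist u p - dist u q| := by
  rw [mem_seg] at hp hq
  have h1 := dist_triangle u p q
  have h2 := dist_triangle u q p
  have := dist_comm p q
  have := dist_comm p v
  have := dist_comm q v
  apply le_antisymm
  · rcases T.four_point u v p q with h | h
    · have := le_abs_self (dist u p - dist u q)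
      linarith
    · have := neg_le_abs (dist u p - dist u q)
      linarith
  · rw [abs_le]
    constructor <;> linarith

theorem eq_of_mem_seg {u v p q : T.carrier} (hp : p ∈ seg u v) (hq : q ∈ seg u v)
    (h : dist u p = dist u q) : p = q := by
  rw [← dist_eq_zero, dist_eq_of_mem_seg hp hq, h, sub_self, abs_zero]

theorem seg_subset_seg {u v p q : T.carrier} (hp : p ∈ seg u v) (hq : q ∈ seg u v) :
    seg p q ⊆ seg u v := by
  wlog h : dist u p ≤ dist u q generalizing p q
  · rw [seg_comm]
    exact this hq hp (le_of_not_ge h)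
  intro w hw
  have hpq : p ∈ seg u q := by
    rw [mem_seg, dist_eq_of_mem_seg hp hq, abs_of_nonpos (by linarith)]
    ring
  refine mem_seg_of_mem_seg_left hq ?_
  rw [seg_comm] at hpq hw ⊢
  exact mem_seg_of_mem_seg_left hpq hw

/-- Local geodesics are geodesic: two segments overlapping in a non-degenerate segment [b, c] cannot
backtrack. If b = c this fails. -/
theorem dist_concat {a b c d : T.carrier} (hb : b ∈ seg a c) (hc : c ∈ seg b d) (hne : b ≠ c) :
    dist a d = dist a b + dist b c + dist c d := by
  rw [mem_seg] at *
  have h0 := dist_pos.mpr hne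
  have h1 := dist_triangle4 a b c d
  have := dist_comm c b
  rcases T.four_point a c b d with h | h <;> linarith

theorem exists_mem_seg (p q : T.carrier) {θ : ℝ} (h0 : 0 ≤ θ) (h1 : θ ≤ 1) :
    ∃ z, dist p z = θ * dist p q ∧ dist z q = (1 - θ) * dist p q := by
  obtain ⟨γ, hγ0, hγ1, hγ⟩ := T.geodesic p q
  have hd := dist_nonneg (x := p) (y := q)
  have m : θ * dist p q ∈ Icc 0 (dist p q) := ⟨by positivity, by nlinarith⟩
  refine ⟨γ (θ * dist p q), ?_, ?_⟩
  · have := hγ 0 ⟨le_rfl, hd⟩ _ m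
    rw [hγ0] at this
    rw [this, zero_sub, abs_neg, abs_of_nonneg m.1]
  · have := hγ _ m _ ⟨hd, le_rfl⟩
    rw [hγ1] at this
    rw [this, abs_of_nonpos (by linarith [m.2])]
    ring

theorem mem_seg_smul (g : G) {x y z : T.carrier} (h : z ∈ seg x y) :
    g • z ∈ seg (g • x) (g • y) := by
  rw [mem_seg] at *
  simpa only [dist_smul] using h

/-! ### Axes of isometries -/

/-- The point `x` lies on the axis of the isometry `g`. -/
def OnAxis (g : G) (x : T.carrier) : Prop := g • x ∈ seg x (g • g • x)

theorem OnAxis.smul {g : G} {x : T.carrier} (h : OnAxis g x) (k : G) :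
    OnAxis (k * g * k⁻¹) (k • x) := by
  have := mem_seg_smul k h
  simpa [OnAxis, mul_smul] using this

theorem OnAxis.inv {g : G} {x : T.carrier} (h : OnAxis g x) : OnAxis g⁻¹ x := by
  have := mem_seg_smul (g⁻¹ * g⁻¹) h
  rw [seg_comm] at this
  simpa [OnAxis, mul_smul] using this

theorem exists_onAxis {g : G} (hg : ∀ x : T.carrier, g • x ≠ x) : ∃ o : T.carrier, OnAxis g o := by
  obtain ⟨x, -⟩ := T.vert_nonempty
  -- The midpoint of [x, gx] lies on the axis: the four-point inequality, applied twice, gives d(m,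
  -- g²m) ≥ 2 d(m, gm), and gm ≠ m rules out the other alternative each time.
  obtain ⟨m, h1, h2⟩ := exists_mem_seg x (g • x) (θ := 1 / 2) (by norm_num) (by norm_num)
  refine ⟨m, ?_⟩
  have e1 : dist (g • x) (g • m) = 1 / 2 * dist x (g • x) := by rw [dist_smul, h1]
  have e2 : dist (g • m) (g • g • x) = (1 - 1 / 2) * dist x (g • x) := by rw [dist_smul, h2]
  have e3 : dist (g • g • x) (g • g • m) = 1 / 2 * dist x (g • x) := by rw [dist_smul, e1]
  have e4 : dist (g • m) (g • g • m) = dist m (g • m) := dist_smul _ _ _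
  have e5 : dist (g • x) (g • g • x) = dist x (g • x) := dist_smul _ _ _
  have hpos := dist_pos.mpr (hg m)
  have c1 := dist_comm m (g • m)
  have c2 := dist_comm (g • m) (g • x)
  have k1 : dist m (g • m) + 1 / 2 * dist x (g • x) ≤ dist m (g • g • x) := by
    rcases T.four_point m (g • m) (g • x) (g • g • x) with h | h <;> linarith
  have k2 : 2 * dist m (g • m) ≤ dist m (g • g • m) := by
    have := dist_comm (g • m) (g • g • x)
    rcases T.four_point m (g • g • x) (g • m) (g • g • m) with h | h <;> linarith
  rw [OnAxis, mem_seg]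
  have := dist_triangle m (g • m) (g • g • m)
  linarith

/-- Consecutive segments overlap in [gⁿx, gⁿ⁺¹x], so `dist_concat` adds lengths. The induction
carries two consecutive values. Fixed points also satisfy `OnAxis`, hence the separate assumption gx
≠ x. -/
theorem OnAxis.dist_pow {g : G} {x : T.carrier} (h : OnAxis g x) (hne : g • x ≠ x) (n : ℕ) :
    dist x (g ^ n • x) = n * dist x (g • x) := by
  have step : ∀ n : ℕ, dist (g ^ n • x) (g ^ (n + 1) • x) = dist x (g • x) := fun n => by
    rw [pow_succ, mul_smul, dist_smul]
  suffices ∀ n : ℕ, dist x (g ^ n • x) = n * dist x (g • x) ∧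
      dist x (g ^ (n + 1) • x) = (n + 1) * dist x (g • x) from (this n).1
  intro n
  induction n with
  | zero => simp
  | succ n ih =>
    refine ⟨by rw [ih.2]; push_cast; ring, ?_⟩
    have hb : g ^ n • x ∈ seg x (g ^ (n + 1) • x) := by
      rw [mem_seg, step, ih.1, ih.2]
      ring
    have hc : g ^ (n + 1) • x ∈ seg (g ^ n • x) (g ^ (n + 1 + 1) • x) := by
      have := mem_seg_smul (g ^ n) h
      simpa only [← mul_smul, pow_succ, mul_assoc] using this
    have hne' : g ^ n • x ≠ g ^ (n + 1) • x := by
      rw [pow_succ, mul_smul]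
      exact fun h => hne (smul_left_cancel _ h).symm
    rw [dist_concat hb hc hne', step, step, ih.1]
    push_cast
    ring

theorem OnAxis.pow {g : G} {x : T.carrier} (h : OnAxis g x) (hne : g • x ≠ x) (n : ℕ) :
    OnAxis (g ^ n) x := by
  rw [OnAxis, mem_seg, dist_smul, ← mul_smul, ← pow_add, h.dist_pow hne, h.dist_pow hne]
  push_cast
  ring

theorem OnAxis.pow_smul_ne {g : G} {x : T.carrier} (h : OnAxis g x) (hne : g • x ≠ x) {n : ℕ}
    (hn : 0 < n) : g ^ n • x ≠ x := by
  rw [ne_comm, ← dist_pos, h.dist_pow hne]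
  have := dist_pos.mpr hne.symm
  positivity

/-- Two points on the axis of `g` have the same displacement. -/
theorem OnAxis.dist_smul_eq {g : G} {x y : T.carrier} (hx : OnAxis g x) (hy : OnAxis g y)
    (hgx : g • x ≠ x) (hgy : g • y ≠ y) : dist y (g • y) = dist x (g • x) := by
  have key : ∀ {x y : T.carrier}, OnAxis g x → OnAxis g y → g • x ≠ x → g • y ≠ y →
      dist y (g • y) ≤ dist x (g • x) := by
    intro x y hx hy hgx hgy
    by_contra! hlt
    -- Displacements by gⁿ at x and y differ by at most 2 d(x, y), while a difference in
    -- displacement by g would grow linearly in n.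
    obtain ⟨n, hn⟩ := exists_nat_gt (2 * dist x y / (dist y (g • y) - dist x (g • x)))
    rw [div_lt_iff₀ (by linarith)] at hn
    have h1 := hx.dist_pow hgx n
    have h2 := hy.dist_pow hgy n
    have h3 := dist_triangle4 y x (g ^ n • x) (g ^ n • y)
    rw [dist_smul, dist_comm y x] at h3
    linarith
  exact le_antisymm (key hx hy hgx hgy) (key hy hx hgy hgx)

/-- The axis of `g` is the union of the segments between the iterates of one of its points. -/
theorem OnAxis.exists_mem_seg {g : G} {x y : T.carrier} (hx : OnAxis g x) (hy : OnAxis g y)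
    (hgx : g • x ≠ x) (hgy : g • y ≠ y) :
    ∃ j : ℕ, y ∈ seg ((g ^ j)⁻¹ • x) (g ^ j • x) := by
  have hl := dist_pos.mpr hgx.symm
  obtain ⟨j, hj⟩ := exists_nat_gt (2 * dist x y / dist x (g • x))
  rw [div_lt_iff₀ hl] at hj
  refine ⟨j, ?_⟩
  have hxy := hx.dist_smul_eq hy hgx hgy
  have inv_dist : ∀ z : T.carrier, dist ((g ^ j)⁻¹ • z) z = dist z (g ^ j • z) := fun z => by
    rw [← dist_smul (g ^ j), smul_inv_smul]
  have two_dist : ∀ z : T.carrier, dist ((g ^ j)⁻¹ • z) (g ^ j • z) = dist z (g ^ (j + j) • z) :=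
    fun z => by rw [← dist_smul (g ^ j), smul_inv_smul, pow_add, mul_smul]
  have x1 := hx.dist_pow hgx j
  have x2 := hx.dist_pow hgx (j + j)
  have y1 := hy.dist_pow hgy j
  have y2 := hy.dist_pow hgy (j + j)
  have x3 := inv_dist x
  have y3 := inv_dist y
  rw [← two_dist] at x2 y2
  rw [hxy] at y1 y2
  push_cast at x2 y2
  have d1 : dist (g ^ j • x) (g ^ j • y) = dist x y := dist_smul _ _ _
  have d2 : dist ((g ^ j)⁻¹ • x) ((g ^ j)⁻¹ • y) = dist x y := dist_smul _ _ _
  rw [mem_seg]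
  generalize g ^ j • x = xp at *
  generalize g ^ j • y = yp at *
  generalize (g ^ j)⁻¹ • x = xm at *
  generalize (g ^ j)⁻¹ • y = ym at *
  have t1 := dist_triangle xm x y
  have t2 := dist_triangle y x xp
  have := dist_comm y x
  have := dist_comm xp y
  have := dist_comm xm ym
  have := dist_comm y ym
  have := dist_comm yp xp
  have := dist_comm y xm
  have := dist_comm yp xm
  have := dist_comm yp y
  have t4 := dist_triangle xm y x
  have t3 := dist_triangle xm y xp
  -- As jℓ > 2 d(x, y), with ℓ the displacement, only one four-point alternative survives in each
  -- case. Adding the two inequalities cancels d(xm, yp), and d(ym, yp) = d(ym, y) + d(y, yp), which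
  -- leaves y between xm and xp.
  have a1 : dist xm yp + dist y xp ≤ dist xm xp + dist y yp := by
    rcases T.four_point xm yp y xp with h | h <;> linarith
  have a2 : dist ym yp + dist y xm ≤ dist ym y + dist yp xm := by
    rcases T.four_point ym yp y xm with h | h <;> linarith
  linarith

end GTree

namespace GTree

variable {G : Type u} [Group G] {T : GTree G}

/-! ### Actions on lines are solvable -/

/-- The coordinate is obtained by polarization: on a line, the given quotient is ±(x - o), with the
sign that makes e positive. Checking that it is isometric involves only the four points x, y, o, e.
-/
theorem exists_isometry_real (H : ∀ x y z w : T.carrier, ∃ p q : T.carrier,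
    x ∈ seg p q ∧ y ∈ seg p q ∧ z ∈ seg p q ∧ w ∈ seg p q) {o e : T.carrier} (hne : o ≠ e) :
    ∃ t : T.carrier → ℝ, ∀ x y, |t x - t y| = dist x y := by
  refine ⟨fun x => (dist x o ^ 2 + dist e o ^ 2 - dist x e ^ 2) / (2 * dist e o), fun x y => ?_⟩
  obtain ⟨p, q, hx, hy, ho, he⟩ := H x y o e
  have hpos := dist_pos.mpr hne.symm
  rw [dist_eq_of_mem_seg he ho] at hpos
  dsimp only
  rw [dist_eq_of_mem_seg hx hy, dist_eq_of_mem_seg hx ho, dist_eq_of_mem_seg he ho,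
    dist_eq_of_mem_seg hx he, dist_eq_of_mem_seg hy ho, dist_eq_of_mem_seg hy he, sq_abs, sq_abs,
    sq_abs, sq_abs, sq_abs, ← sub_div, abs_div, abs_mul, abs_abs, abs_two, div_eq_iff (by positivity)]
  rw [show |dist p x - dist p y| * (2 * |dist p e - dist p o|) =
    |(dist p x - dist p y) * (2 * (dist p e - dist p o))| by simp [abs_mul]]
  congr 1
  ring

/-- Polarization again: the three distances determine the product (x - o)(e - o), so a
distance-preserving map of the line is affine with slope ±1. -/
theorem sub_eq_mul_sub_of_abs_eq {x e o x' e' o' : ℝ} (hxo : |x' - o'| = |x - o|)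
    (hxe : |x' - e'| = |x - e|) (heo : |e' - o'| = |e - o|) (hne : e - o ≠ 0) :
    x' - o' = (e' - o') / (e - o) * (x - o) := by
  rw [← sq_eq_sq_iff_abs_eq_abs] at hxo hxe heo
  have h1 : (x' - o') * (e' - o') = (x - o) * (e - o) := by linarith
  have h2 : e' - o' ≠ 0 := by
    intro h
    rw [h] at heo
    exact hne (by simpa using heo.symm)
  rw [div_mul_eq_mul_div, eq_div_iff hne]
  apply mul_right_cancel₀ h2
  calc (x' - o') * (e - o) * (e' - o') = (x' - o') * (e' - o') * (e - o) := by ring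
    _ = (x - o) * (e - o) ^ 2 := by rw [h1]; ring
    _ = _ := by rw [← heo]; ring

theorem isSolvable_of_isometry_real {t : T.carrier → ℝ} (ht : ∀ x y, |t x - t y| = dist x y)
    {o e : T.carrier} (hne : o ≠ e) (hcyc : IsCyclic (MulAction.stabilizer G o)) :
    Group.IsSolvable G := by
  have hto : t e - t o ≠ 0 := by
    rw [← abs_pos, ht]
    exact dist_pos.mpr hne.symm
  have htg : ∀ (g : G) x y, |t (g • x) - t (g • y)| = |t x - t y| := fun g x y => by
    rw [ht, ht, dist_smul]
  have hε : ∀ (g : G) x y,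
      t (g • x) - t (g • y) = (t (g • e) - t (g • o)) / (t e - t o) * (t x - t y) := by
    intro g x y
    have h1 := sub_eq_mul_sub_of_abs_eq (htg g x o) (htg g x e) (htg g e o) hto
    have h2 := sub_eq_mul_sub_of_abs_eq (htg g y o) (htg g y e) (htg g e o) hto
    linear_combination h1 - h2
  -- G is filtered by abelian layers: `ε` records orientation, its kernel acts by translations
  -- recorded by `c`, and the kernel of `c` fixes o, so embeds in a cyclic group.
  let ε : G →* ℝ :=
    { toFun := fun g => (t (g • e) - t (g • o)) / (t e - t o)
      map_one' := by simp only [one_smul]; exact div_self hto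
      map_mul' := fun g h => by
        simp only [mul_smul]
        rw [hε g (h • e) (h • o), mul_div_assoc] }
  have hN : ∀ (g : ε.toHomUnits.ker) x y, t (g.1 • x) - t (g.1 • y) = t x - t y := by
    intro g x y
    have : ε g.1 = 1 := congrArg Units.val g.2
    rw [hε, show (t (g.1 • e) - t (g.1 • o)) / (t e - t o) = 1 from this, one_mul]
  let c : ε.toHomUnits.ker →* Multiplicative ℝ :=
    { toFun := fun g => Multiplicative.ofAdd (t (g.1 • o) - t o)
      map_one' := by simp
      map_mul' := fun g h => by
        rw [← ofAdd_add]
        congr 1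
        have := hN g (h.1 • o) o
        rw [Subgroup.coe_mul, mul_smul]
        linarith }
  have hker : ∀ k : c.ker, k.1.1 ∈ MulAction.stabilizer G o := by
    intro k
    have : t (k.1.1 • o) - t o = 0 := Multiplicative.ofAdd.injective k.2
    rw [MulAction.mem_stabilizer_iff, ← dist_eq_zero, ← ht, this, abs_zero]
  have s0 : Group.IsSolvable (MulAction.stabilizer G o) :=
    Group.isSolvable_of_comm fun a b => hcyc.isMulCommutative.is_comm.comm a b
  have s1 : Group.IsSolvable c.ker := by
    let i : c.ker →* MulAction.stabilizer G o :=
      (ε.toHomUnits.ker.subtype.comp c.ker.subtype).codRestrict _ hker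
    refine Group.isSolvable_of_isSolvable_injective (f := i) fun a b h => ?_
    have hab : (i a : G) = i b := by rw [h]
    exact Subtype.ext (Subtype.ext hab)
  have s2 : Group.IsSolvable ε.toHomUnits.ker :=
    Group.isSolvable_of_ker_le_range c.ker.subtype c (by simp)
  exact Group.isSolvable_of_ker_le_range ε.toHomUnits.ker.subtype ε.toHomUnits (by simp)

/-! ### Invariant axes -/

/-- The segment between the iterates `g⁻ʲ o` and `gʲ o`. -/
def axisSeg (g : G) (o : T.carrier) (j : ℕ) : Set T.carrier := seg ((g ^ j)⁻¹ • o) (g ^ j • o)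

theorem pow_smul_mem_axisSeg {g : G} {o : T.carrier} (ho : OnAxis g o) (hne : g • o ≠ o) {j k : ℕ}
    (hjk : j ≤ k) : g ^ j • o ∈ axisSeg g o k := by
  obtain ⟨i, rfl⟩ := Nat.exists_eq_add_of_le hjk
  have h1 : ∀ n, dist ((g ^ (j + i))⁻¹ • o) (g ^ n • o) = (j + i + n : ℕ) * dist o (g • o) := by
    intro n
    rw [← dist_smul (g ^ (j + i)), smul_inv_smul, ← mul_smul, ← pow_add, ho.dist_pow hne]
  have h2 : dist (g ^ j • o) (g ^ (j + i) • o) = i * dist o (g • o) := by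
    rw [pow_add, mul_smul, dist_smul, ho.dist_pow hne]
  rw [axisSeg, mem_seg, h1, h1, h2]
  push_cast
  ring

theorem axisSeg_mono {g : G} {o : T.carrier} (ho : OnAxis g o) (hne : g • o ≠ o) :
    Monotone (axisSeg g o) := by
  intro j k hjk
  refine seg_subset_seg ?_ (pow_smul_mem_axisSeg ho hne hjk)
  have h := pow_smul_mem_axisSeg ho.inv (fun h => hne (inv_smul_eq_iff.mp h).symm) hjk
  rw [axisSeg, seg_comm] at h
  simpa using h

/-- If `g` has no fixed point in a minimal tree and has a power in common with all its
conjugates, then any finite set of points is contained in a segment. -/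
theorem exists_seg_of_commensurated (hT : T.IsMinimal) {g : G} (hg : ∀ x : T.carrier, g • x ≠ x)
    (hcomm : ∀ k : G, ∃ (p : ℕ) (q : ℤ), 0 < p ∧ (k * g * k⁻¹) ^ p = g ^ q)
    (x y z w : T.carrier) : ∃ p q : T.carrier,
      x ∈ seg p q ∧ y ∈ seg p q ∧ z ∈ seg p q ∧ w ∈ seg p q := by
  obtain ⟨o, ho⟩ := exists_onAxis hg
  have hmono := axisSeg_mono ho (hg o)
  let Y : Set T.carrier := ⋃ j, axisSeg g o j
  have hconv : ∀ x ∈ Y, ∀ y ∈ Y, seg x y ⊆ Y := by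
    intro x hx y hy
    obtain ⟨j, hj⟩ := mem_iUnion.mp hx
    obtain ⟨k, hk⟩ := mem_iUnion.mp hy
    exact (seg_subset_seg (hmono (le_max_left j k) hj) (hmono (le_max_right j k) hk)).trans
      (subset_iUnion (axisSeg g o) (max j k))
  -- The point k • o is on the axis of kgk⁻¹, hence of its p-th power g^q. Replacing q by m = |q|,
  -- it is on the axis of gᵐ, which is covered by the segments of `Y`; m ≠ 0 because that power
  -- moves k • o.
  have horb : ∀ k : G, k • o ∈ Y := by
    intro k
    obtain ⟨p, q, hp, hpq⟩ := hcomm k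
    have hk : (k * g * k⁻¹) • k • o ≠ k • o := by
      simpa [mul_smul] using hg o
    have h1 := (ho.smul k).pow hk p
    have h2 := (ho.smul k).pow_smul_ne hk hp
    rw [hpq] at h1 h2
    obtain ⟨m, h3, h4⟩ : ∃ m : ℕ, OnAxis (g ^ m) (k • o) ∧ g ^ m • k • o ≠ k • o := by
      rcases Int.eq_nat_or_neg q with ⟨m, rfl | rfl⟩
      · exact ⟨m, by simpa using h1, by simpa using h2⟩
      · refine ⟨m, by simpa using h1.inv, ?_⟩
        intro h
        exact h2 (by rw [zpow_neg, zpow_natCast, inv_smul_eq_iff, h])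
    have hm : 0 < m := by
      rcases Nat.eq_zero_or_pos m with rfl | h
      · simp at h4
      · exact h
    obtain ⟨j, hj⟩ := (ho.pow (hg o) m).exists_mem_seg h3 (ho.pow_smul_ne (hg o) hm) h4
    exact mem_iUnion.mpr ⟨m * j, by rwa [axisSeg, pow_mul]⟩
  have huniv : Y = univ := by
    refine hT Y ⟨o, by simpa using horb 1⟩ hconv fun k x hx => ?_
    obtain ⟨j, hj⟩ := mem_iUnion.mp hx
    refine hconv _ ?_ _ ?_ (mem_seg_smul k hj)
    · rw [← mul_smul]
      exact horb _
    · rw [← mul_smul]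
      exact horb _
  have hY : ∀ x, ∃ j, x ∈ axisSeg g o j := fun x => mem_iUnion.mp (huniv ▸ mem_univ x : x ∈ Y)
  obtain ⟨a, ha⟩ := hY x
  obtain ⟨b, hb⟩ := hY y
  obtain ⟨c, hc⟩ := hY z
  obtain ⟨d, hd⟩ := hY w
  exact ⟨_, _, hmono (show a ≤ a + b + c + d by omega) ha,
    hmono (show b ≤ a + b + c + d by omega) hb, hmono (show c ≤ a + b + c + d by omega) hc,
    hmono (show d ≤ a + b + c + d by omega) hd⟩

/-! ### Vertex stabilizers -/

/-- A relation between vertices holds if it is reflexive, transitive along segments, and holds for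
the end points of edges. -/
theorem vert_induction {P : T.carrier → T.carrier → Prop} (refl : ∀ v ∈ T.vert, P v v)
    (edge : ∀ v w, IsEdge T.vert v w → P v w)
    (trans : ∀ v u w, u ∈ seg v w → P v u → P u w → P v w) :
    ∀ v ∈ T.vert, ∀ w ∈ T.vert, P v w := by
  -- Induction on the number of vertices of [v, w]: an interior vertex splits the segment into two
  -- smaller ones, and if there is none, it is an edge.
  suffices ∀ (n : ℕ), ∀ v ∈ T.vert, ∀ w ∈ T.vert, (seg v w ∩ T.vert).ncard = n → P v w from
    fun v hv w hw => this _ v hv w hw rfl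
  intro n
  induction n using Nat.strong_induction_on with
  | _ n ih =>
    rintro v hv w hw rfl
    by_cases hvw : v = w
    · exact hvw ▸ refl v hv
    by_cases h : ∃ u ∈ seg v w ∩ T.vert, u ≠ v ∧ u ≠ w
    · obtain ⟨u, ⟨hu, huV⟩, huv, huw⟩ := h
      have lt : ∀ a b, seg a b ⊆ seg v w → (w ∉ seg a b ∨ v ∉ seg a b) →
          (seg a b ∩ T.vert).ncard < (seg v w ∩ T.vert).ncard := by
        intro a b hab hn
        refine ncard_lt_ncard (ssubset_of_subset_of_ne (inter_subset_inter_left _ hab) ?_)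
          (T.vert_finite v w)
        intro he
        rcases hn with hn | hn
        · exact hn (he.symm.subset ⟨right_mem_seg v w, hw⟩).1
        · exact hn (he.symm.subset ⟨left_mem_seg v w, hv⟩).1
      have h1 := dist_pos.mpr huv
      have h2 := dist_pos.mpr huw
      have c1 := dist_comm u v
      have c2 := dist_comm u w
      refine trans v u w hu (ih _ (lt v u (seg_subset_seg (left_mem_seg v w) hu) (Or.inl ?_)) v hv u
        huV rfl) (ih _ (lt u w (seg_subset_seg hu (right_mem_seg v w)) (Or.inr ?_)) u huV w hw rfl)
      · intro hw
        rw [mem_seg] at hu hw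
        linarith
      · intro hv
        rw [mem_seg] at hu hv
        linarith
    · push Not at h
      refine edge v w ⟨hv, hw, hvw, ?_⟩
      ext u
      simp only [mem_insert_iff, mem_singleton_iff]
      constructor
      · intro hu
        by_cases huv : u = v
        · exact Or.inl huv
        · exact Or.inr (h u hu huv)
      · rintro (rfl | rfl)
        · exact ⟨left_mem_seg _ _, hv⟩
        · exact ⟨right_mem_seg _ _, hw⟩

/-- For adjacent vertices, the edge group is a non-trivial subgroup of ⟨h⟩ = G_v, so it contains
some hᵃ with a ≠ 0, and |a|-th powers of elements of G_v fix w. Exponents multiply along paths. -/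
theorem HasCyclicStabilizers.exists_pow_mem_stabilizer (hT : T.HasCyclicStabilizers) :
    ∀ v ∈ T.vert, ∀ w ∈ T.vert, ∀ g ∈ MulAction.stabilizer G v,
      ∃ n : ℕ, 0 < n ∧ g ^ n ∈ MulAction.stabilizer G w := by
  refine vert_induction (fun v _ g hg => ⟨1, one_pos, by simpa using hg⟩) ?_ ?_
  · intro v w hvw g hg
    obtain ⟨h, hh⟩ := Subgroup.isCyclic_iff_exists_zpowers_eq_top _ |>.mp (hT.1 v hvw.1).1
    have := (hT.2 v w hvw).2
    obtain ⟨⟨k, hk⟩, hk1⟩ := exists_ne (1 : ↥(MulAction.stabilizer G v ⊓ MulAction.stabilizer G w))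
    rw [← hh] at hg hk
    obtain ⟨⟨a, ha⟩, hkw⟩ := hk
    obtain ⟨b, hb⟩ := hg
    dsimp only at ha hb
    have ha0 : a ≠ 0 := by
      rintro rfl
      exact hk1 (Subtype.ext (by simpa using ha.symm))
    refine ⟨a.natAbs, Int.natAbs_pos.mpr ha0, ?_⟩
    have hmem : h ^ a.natAbs ∈ MulAction.stabilizer G w := by
      rw [← zpow_natCast]
      rcases Int.natAbs_eq a with e | e
      · rw [← e, ha]
        exact hkw
      · rw [← neg_eq_iff_eq_neg.mpr e, zpow_neg, ha]
        exact inv_mem hkw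
    rw [← hb, ← zpow_natCast, ← zpow_mul, mul_comm, zpow_mul, zpow_natCast]
    exact zpow_mem hmem b
  · intro v u w _ h1 h2 g hg
    obtain ⟨n, hn, hgn⟩ := h1 g hg
    obtain ⟨m, hm, hgm⟩ := h2 _ hgn
    exact ⟨n * m, Nat.mul_pos hn hm, by rwa [pow_mul]⟩

/-- Vertex stabilizers of a tree of the cyclic deformation space are elliptic in all other trees. -/
theorem exists_fixed_of_stabilizer (hsol : ¬ Group.IsSolvable G) {A B : GTree G}
    (hA : A.HasCyclicStabilizers) (hB : B.HasCyclicStabilizers) (hBm : B.IsMinimal) {v : A.carrier}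
    (hv : v ∈ A.vert) : ∃ p : B.carrier, ∀ g ∈ MulAction.stabilizer G v, g • p = p := by
  by_contra! hno
  obtain ⟨h, hh⟩ := Subgroup.isCyclic_iff_exists_zpowers_eq_top _ |>.mp (hA.1 v hv).1
  have hfree : ∀ x : B.carrier, h • x ≠ x := by
    intro x hx
    obtain ⟨g, hg, hgx⟩ := hno x
    rw [← hh] at hg
    have : Subgroup.zpowers h ≤ MulAction.stabilizer G x := by
      rw [Subgroup.zpowers_le]
      exact hx
    exact hgx (this hg)
  -- The conjugate khk⁻¹ fixes k • v, so a positive power of it fixes v too and lies in ⟨h⟩.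
  have hcomm : ∀ k : G, ∃ (p : ℕ) (q : ℤ), 0 < p ∧ (k * h * k⁻¹) ^ p = h ^ q := by
    intro k
    have hhv : h • v = v := by
      rw [← MulAction.mem_stabilizer_iff, ← hh]
      exact Subgroup.mem_zpowers h
    obtain ⟨p, hp, hmem⟩ := hA.exists_pow_mem_stabilizer (k • v) (A.smul_vert k v hv) v hv
      (k * h * k⁻¹) (by simp [MulAction.mem_stabilizer_iff, mul_smul, hhv])
    rw [← hh] at hmem
    obtain ⟨q, hq⟩ := hmem
    exact ⟨p, q, hp, hq.symm⟩
  obtain ⟨o, ho⟩ := B.vert_nonempty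
  obtain ⟨t, ht⟩ := exists_isometry_real (exists_seg_of_commensurated hBm hfree hcomm)
    (hfree o).symm
  exact hsol (isSolvable_of_isometry_real ht (hfree o).symm (hB.1 o ho).1)

end GTree

/-! ### Finite generation -/

theorem IsGBS.fg {G : Type u} [Group G] (hG : IsGBS G) : Group.FG G := by
  obtain ⟨Γ, τ, -, ⟨e⟩⟩ := hG
  have := Γ.finite_V
  have := Γ.finite_E
  have : Group.FG (Γ.π₁ τ) := QuotientGroup.fg _
  exact Group.fg_of_surjective (f := e.symm.toMonoidHom) e.symm.surjective

namespace GTree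

variable {G : Type u} [Group G] {T : GTree G}

/-! ### Finiteness of the quotient graph -/

/-- From x, the paths to a and to b each leave the edge through an end point. They cannot share one,
since x lies between a and b. -/
theorem mem_seg_of_crosses_edge {u w x a b : T.carrier} (h : IsEdge T.vert u w) (hx : x ∈ seg u w)
    (hxu : x ≠ u) (hxw : x ≠ w) (ha : a ∈ T.vert) (hb : b ∈ T.vert) (hab : x ∈ seg a b) :
    u ∈ seg a b ∧ w ∈ seg a b := by
  have key : ∀ a ∈ T.vert, u ∈ seg x a ∨ w ∈ seg x a := by
    intro a ha
    by_cases hm : a ∈ seg u w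
    · rcases (h.2.2.2.subset ⟨hm, ha⟩ : a = u ∨ a = w) with rfl | rfl
      · exact Or.inl (right_mem_seg _ _)
      · exact Or.inr (right_mem_seg _ _)
    · exact T.leave_edge u w x a h hx hm
  have not_both : ∀ c, x ≠ c → c ∈ seg x a → c ∈ seg x b → False := by
    intro c hc h1 h2
    rw [mem_seg] at h1 h2 hab
    have := dist_pos.mpr hc
    have := dist_triangle a c b
    have := dist_comm a x
    have := dist_comm a c
    linarith
  have to_a : ∀ c, c ∈ seg x a → c ∈ seg a b := fun c hc => by
    rw [seg_comm] at hc
    exact mem_seg_of_mem_seg_left hab hc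
  have to_b : ∀ c, c ∈ seg x b → c ∈ seg a b := fun c hc => by
    rw [seg_comm] at hc hab ⊢
    exact mem_seg_of_mem_seg_left hab hc
  rcases key a ha with h1 | h1 <;> rcases key b hb with h2 | h2
  · exact (not_both u hxu h1 h2).elim
  · exact ⟨to_a u h1, to_b w h2⟩
  · exact ⟨to_b u h2, to_a w h1⟩
  · exact (not_both w hxw h1 h2).elim

theorem edge_unique {u w u' w' x : T.carrier} (h : IsEdge T.vert u w) (h' : IsEdge T.vert u' w')
    (hx : x ∈ seg u w) (hx' : x ∈ seg u' w') (hxV : x ∉ T.vert) :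
    u = u' ∧ w = w' ∨ u = w' ∧ w = u' := by
  obtain ⟨h1, h2⟩ := mem_seg_of_crosses_edge h hx (fun e => hxV (e ▸ h.1))
    (fun e => hxV (e ▸ h.2.1)) h'.1 h'.2.1 hx'
  have e1 : u = u' ∨ u = w' := h'.2.2.2.subset ⟨h1, h.1⟩
  have e2 : w = u' ∨ w = w' := h'.2.2.2.subset ⟨h2, h.2.1⟩
  have := h.2.2.1
  grind

/-- The translates of the segments [v, sv], for s in a finite generating set, cover an invariant
subtree, hence the whole tree. A translate containing the midpoint of an edge contains both end
points, and each segment has finitely many vertices. -/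
theorem exists_finite_edge_representatives (hG : Group.FG G) (hT : T.IsMinimal) :
    ∃ F : Set (T.carrier × T.carrier), F.Finite ∧
      ∀ u w, IsEdge T.vert u w → ∃ g : G, (g • u, g • w) ∈ F := by
  obtain ⟨S, hS⟩ := hG.out
  obtain ⟨v, hv⟩ := T.vert_nonempty
  -- Including 1 keeps v in `Y` even when `S` is empty.
  let S' : Set G := insert 1 (S : Set G)
  refine ⟨⋃ s ∈ S', (seg v (s • v) ∩ T.vert) ×ˢ (seg v (s • v) ∩ T.vert),
    (S.finite_toSet.insert 1).biUnion fun s _ => (T.vert_finite _ _).prod (T.vert_finite _ _), ?_⟩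
  let Y : Set T.carrier := {x | ∃ g : G, ∃ s ∈ S', x ∈ seg (g • v) (g • s • v)}
  have horb : ∀ k g : G, seg (g • v) (g • k • v) ⊆ Y := by
    intro k
    have hk : k ∈ Subgroup.closure (S : Set G) := hS ▸ Subgroup.mem_top k
    induction hk using Subgroup.closure_induction with
    | mem s hs => exact fun g x hx => ⟨g, s, Or.inr hs, hx⟩
    | one => exact fun g x hx => ⟨g, 1, Or.inl rfl, hx⟩
    | mul a b _ _ iha ihb =>
      intro g x hx
      rcases mem_seg_or_mem_seg hx (g • a • v) with h | h
      · exact iha g h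
      · refine ihb (g * a) ?_
        simpa only [mul_smul] using h
    | inv a _ iha =>
      intro g x hx
      refine iha (g * a⁻¹) ?_
      rw [seg_comm] at hx
      simpa only [mul_smul, inv_smul_smul] using hx
  have hYuniv : Y = univ := by
    refine hT Y ⟨v, 1, 1, Or.inl rfl, by simp [left_mem_seg]⟩ ?_ ?_
    · rintro x ⟨g, s, hs, hx⟩ y ⟨g', s', hs', hy⟩ z hz
      rcases mem_seg_or_mem_seg hz (g • v) with h | h
      · refine ⟨g, s, hs, ?_⟩
        exact seg_subset_seg hx (left_mem_seg _ _) h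
      rcases mem_seg_or_mem_seg h (g' • v) with h | h
      · refine horb (g⁻¹ * g') g ?_
        rwa [← mul_smul, mul_inv_cancel_left]
      · refine ⟨g', s', hs', ?_⟩
        exact seg_subset_seg (left_mem_seg _ _) hy h
    · rintro g x ⟨k, s, hs, hx⟩
      refine ⟨g * k, s, hs, ?_⟩
      simpa only [mul_smul] using mem_seg_smul g hx
  intro u w h
  obtain ⟨x, h1, h2⟩ := exists_mem_seg u w (θ := 1 / 2) (by norm_num) (by norm_num)
  have hpos := dist_pos.mpr h.2.2.1
  obtain ⟨g, s, hs, hx⟩ : x ∈ Y := hYuniv ▸ mem_univ x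
  have hsv : s • v ∈ T.vert := T.smul_vert s v hv
  obtain ⟨h3, h4⟩ := mem_seg_of_crosses_edge h (x := x) (by rw [mem_seg]; linarith)
    (by rintro rfl; simp at h1; linarith) (by rintro rfl; simp at h2; linarith)
    (T.smul_vert g v hv) (T.smul_vert g _ hsv) hx
  refine ⟨g⁻¹, mem_biUnion hs ⟨⟨?_, T.smul_vert _ _ h.1⟩, ⟨?_, T.smul_vert _ _ h.2.1⟩⟩⟩
  · simpa using mem_seg_smul g⁻¹ h3
  · simpa using mem_seg_smul g⁻¹ h4

/-! ### Equivariant Lipschitz maps -/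

variable {A B : GTree G}

/-- An orbit representative is sent to a point fixed by its stabilizer. Equivariance holds since two
elements carrying it to the same vertex differ by an element of that stabilizer. -/
theorem exists_equivariant_on_vert
    (h : ∀ v ∈ A.vert, ∃ p : B.carrier, ∀ g ∈ MulAction.stabilizer G v, g • p = p) :
    ∃ F : A.carrier → B.carrier, ∀ (g : G), ∀ v ∈ A.vert, F (g • v) = g • F v := by
  have h' : ∀ v : A.carrier, ∃ p : B.carrier,
      v ∈ A.vert → ∀ g ∈ MulAction.stabilizer G v, g • p = p := by
    intro v
    by_cases hv : v ∈ A.vert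
    · obtain ⟨p, hp⟩ := h v hv
      exact ⟨p, fun _ => hp⟩
    · exact ⟨B.vert_nonempty.some, fun hv' => (hv hv').elim⟩
  choose p hp using h'
  let rep : A.carrier → A.carrier := fun x =>
    (Quotient.mk (MulAction.orbitRel G A.carrier) x).out
  have hrep : ∀ x, ∃ k : G, k • rep x = x := fun x => by
    have : (MulAction.orbitRel G A.carrier) x (rep x) :=
      (MulAction.orbitRel G A.carrier).symm (Quotient.mk_out (s := MulAction.orbitRel G A.carrier) x)
    exact this
  choose k hk using hrep
  refine ⟨fun x => k x • p (rep x), fun g v hv => ?_⟩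
  have hr : rep (g • v) = rep v := by
    refine congrArg Quotient.out (Quotient.sound (s := MulAction.orbitRel G A.carrier) ?_)
    exact ⟨g, rfl⟩
  have hrV : rep v ∈ A.vert := by
    have := A.smul_vert (k v)⁻¹ v hv
    rwa [← eq_inv_smul_iff.mpr (hk v)] at this
  have := hp (rep v) hrV ((k (g • v))⁻¹ * (g * k v)) (by
    rw [MulAction.mem_stabilizer_iff, mul_smul, mul_smul, hk, inv_smul_eq_iff]
    rw [← hr, hk])
  rw [mul_smul, inv_smul_eq_iff, mul_smul] at this
  dsimp only
  rw [hr, ← this]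

/-- The point `y` is the image of the point `x` of the edge `[v, w]` under the map which is linear
on `[v, w]` and agrees with `F` at the end points. -/
def LinearImage (F : A.carrier → B.carrier) (v w x : A.carrier) (y : B.carrier) : Prop :=
  dist (F v) y = dist v x / dist v w * dist (F v) (F w) ∧
    dist y (F w) = dist x w / dist v w * dist (F v) (F w)

theorem LinearImage.symm {F : A.carrier → B.carrier} {v w x : A.carrier} {y : B.carrier}
    (h : LinearImage F v w x y) : LinearImage F w v x y := by
  obtain ⟨h1, h2⟩ := h
  refine ⟨?_, ?_⟩
  · rw [dist_comm, h2, dist_comm w x, dist_comm w v, dist_comm (F w)]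
  · rw [dist_comm, h1, dist_comm x v, dist_comm w v, dist_comm (F w)]

theorem LinearImage.mem_seg {F : A.carrier → B.carrier} {v w x : A.carrier} {y : B.carrier}
    (h : LinearImage F v w x y) (hvw : v ≠ w) (hx : x ∈ seg v w) : y ∈ seg (F v) (F w) := by
  rw [_root_.mem_seg] at *
  have := (dist_pos.mpr hvw).ne'
  rw [h.1, h.2, ← add_mul, ← add_div, hx, div_self this, one_mul]

/-- The relation `R` determines the image of x: a non-vertex lies on only one edge up to
orientation, and a point of a segment is determined by its distance to an end. Equivariance follows
from this uniqueness. -/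
theorem exists_equivariant_linear {F : A.carrier → B.carrier}
    (hF : ∀ (g : G), ∀ v ∈ A.vert, F (g • v) = g • F v) :
    ∃ f : A.carrier → B.carrier, (∀ (g : G) (x : A.carrier), f (g • x) = g • f x) ∧
      ∀ v w, IsEdge A.vert v w → ∀ x ∈ seg v w, LinearImage F v w x (f x) := by
  let R : A.carrier → B.carrier → Prop := fun x y => (x ∈ A.vert → y = F x) ∧
    (x ∉ A.vert → ∃ v w, IsEdge A.vert v w ∧ x ∈ seg v w ∧ LinearImage F v w x y)
  have hex : ∀ x, ∃ y, R x y := by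
    intro x
    by_cases hx : x ∈ A.vert
    · exact ⟨F x, fun _ => rfl, fun h => (h hx).elim⟩
    · obtain ⟨v, w, hvw, hm⟩ := (A.cover x).resolve_left hx
      have hpos := dist_pos.mpr hvw.2.2.1
      have hm' := hm
      rw [_root_.mem_seg] at hm'
      have := dist_nonneg (x := x) (y := w)
      obtain ⟨y, h1, h2⟩ := exists_mem_seg (F v) (F w) (θ := dist v x / dist v w) (by positivity)
        (by rw [div_le_one hpos]; linarith)
      refine ⟨y, fun h => (hx h).elim, fun _ => ⟨v, w, hvw, hm, h1, ?_⟩⟩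
      rw [h2, one_sub_div hpos.ne', ← hm', add_sub_cancel_left]
  have huniq : ∀ x y y', R x y → R x y' → y = y' := by
    intro x y y' h h'
    by_cases hx : x ∈ A.vert
    · rw [h.1 hx, h'.1 hx]
    · obtain ⟨v, w, hvw, hm, hl⟩ := h.2 hx
      obtain ⟨v', w', hvw', hm', hl'⟩ := h'.2 hx
      have hl'' : LinearImage F v w x y' := by
        rcases edge_unique hvw hvw' hm hm' hx with ⟨rfl, rfl⟩ | ⟨rfl, rfl⟩
        · exact hl'
        · exact hl'.symm
      exact eq_of_mem_seg (hl.mem_seg hvw.2.2.1 hm) (hl''.mem_seg hvw.2.2.1 hm)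
        (by rw [hl.1, hl''.1])
  choose f hf using hex
  refine ⟨f, fun g x => huniq _ _ _ (hf _) ⟨fun hx => ?_, fun hx => ?_⟩, fun v w hvw x hx => ?_⟩
  · have hx' : x ∈ A.vert := by simpa using A.smul_vert g⁻¹ _ hx
    rw [hF g x hx', (hf x).1 hx']
  · obtain ⟨v, w, hvw, hm, h1, h2⟩ := (hf x).2 fun h => hx (A.smul_vert g x h)
    refine ⟨g • v, g • w, A.isEdge_smul g hvw, mem_seg_smul g hm, ?_⟩
    rw [LinearImage, hF g v hvw.1, hF g w hvw.2.1]
    simp only [dist_smul]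
    exact ⟨h1, h2⟩
  · have hpos := (dist_pos.mpr hvw.2.2.1).ne'
    by_cases hxV : x ∈ A.vert
    · rcases (hvw.2.2.2.subset ⟨hx, hxV⟩ : x = v ∨ x = w) with rfl | rfl
      · rw [(hf x).1 hxV, LinearImage]
        simp [hpos]
      · rw [(hf x).1 hxV, LinearImage]
        simp [hpos]
    · obtain ⟨v', w', hvw', hm', hl'⟩ := (hf x).2 hxV
      rcases edge_unique hvw hvw' hx hm' hxV with ⟨rfl, rfl⟩ | ⟨rfl, rfl⟩
      · exact hl'
      · exact hl'.symm

/-- A map which is Lipschitz on edges is Lipschitz. -/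
theorem lipschitzWith_of_edges {f : A.carrier → B.carrier} {K : ℝ≥0}
    (h : ∀ v w, IsEdge A.vert v w → ∀ x ∈ seg v w, ∀ y ∈ seg v w,
      dist (f x) (f y) ≤ K * dist x y) : LipschitzWith K f := by
  have trans : ∀ v u w, u ∈ seg v w → dist (f v) (f u) ≤ K * dist v u →
      dist (f u) (f w) ≤ K * dist u w → dist (f v) (f w) ≤ K * dist v w := by
    intro v u w hu h1 h2
    rw [mem_seg] at hu
    have := dist_triangle (f v) (f u) (f w)
    rw [← hu, mul_add]
    linarith
  -- Reduces the first point to vertices while y is fixed; it is used twice, by symmetry, to reduce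
  -- both points.
  have step : ∀ y, (∀ v ∈ A.vert, dist (f v) (f y) ≤ K * dist v y) →
      ∀ x, dist (f x) (f y) ≤ K * dist x y := by
    intro y hy x
    rcases A.cover x with hx | ⟨v, w, hvw, hx⟩
    · exact hy x hx
    by_cases hyvw : y ∈ seg v w
    · exact h v w hvw x hx y hyvw
    rcases A.leave_edge v w x y hvw hx hyvw with hm | hm
    · exact trans x v y hm (h v w hvw x hx v (left_mem_seg v w)) (hy v hvw.1)
    · exact trans x w y hm (h v w hvw x hx w (right_mem_seg v w)) (hy w hvw.2.1)
  have hvert := vert_induction (T := A) (P := fun v w => dist (f v) (f w) ≤ K * dist v w)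
    (fun v _ => by simp) (fun v w hvw => h v w hvw v (left_mem_seg v w) w (right_mem_seg v w)) trans
  refine LipschitzWith.of_dist_le_mul fun x y => step y (fun v hv => ?_) x
  rw [dist_comm, dist_comm v]
  exact step v (fun w hw => hvert w hw v hv) y

theorem exists_lipschitz (hG : Group.FG G) (hsol : ¬ Group.IsSolvable G)
    (hA : A.HasCyclicStabilizers) (hAm : A.IsMinimal) (hB : B.HasCyclicStabilizers)
    (hBm : B.IsMinimal) : ∃ (K : ℝ≥0) (f : A.carrier → B.carrier),
      (∀ (g : G) (x : A.carrier), f (g • x) = g • f x) ∧ LipschitzWith K f := by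
  obtain ⟨F, hF⟩ := exists_equivariant_on_vert (A := A) (B := B)
    fun v hv => exists_fixed_of_stabilizer hsol hA hB hBm hv
  obtain ⟨f, hfe, hfl⟩ := exists_equivariant_linear hF
  obtain ⟨E, hE, hrep⟩ := exists_finite_edge_representatives hG hAm
  -- The slope on an edge depends only on its orbit, so K need only bound finitely many slopes.
  obtain ⟨K, hK⟩ := (hE.image fun e => (nndist (F e.1) (F e.2) / nndist e.1 e.2)).bddAbove
  refine ⟨K, f, hfe, lipschitzWith_of_edges fun v w hvw x hx y hy => ?_⟩
  have hpos := dist_pos.mpr hvw.2.2.1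
  have hslope : dist (F v) (F w) / dist v w ≤ K := by
    obtain ⟨g, hg⟩ := hrep v w hvw
    have := NNReal.coe_le_coe.mpr (hK (mem_image_of_mem _ hg))
    simpa [hF g v hvw.1, hF g w hvw.2.1] using this
  have h1 := hfl v w hvw x hx
  have h2 := hfl v w hvw y hy
  rw [dist_eq_of_mem_seg (h1.mem_seg hvw.2.2.1 hx) (h2.mem_seg hvw.2.2.1 hy), h1.1, h2.1,
    dist_eq_of_mem_seg hx hy]
  rw [show dist v x / dist v w * dist (F v) (F w) - dist v y / dist v w * dist (F v) (F w) =
    dist (F v) (F w) / dist v w * (dist v x - dist v y) by ring, abs_mul, abs_of_nonneg (by positivity)]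
  gcongr

/-! ### The Lipschitz metric -/

theorem exists_lipschitz_of_lip_lt {C : ℝ≥0∞} (h : A.lip B < C) :
    ∃ (K : ℝ≥0) (f : A.carrier → B.carrier), (∀ (g : G) (x : A.carrier), f (g • x) = g • f x) ∧
      LipschitzWith K f ∧ (K : ℝ≥0∞) < C := by
  simp only [lip, iInf_lt_iff] at h
  obtain ⟨K, ⟨f, h1, h2⟩, h3⟩ := h
  exact ⟨K, f, h1, h2, h3⟩

theorem lip_le_of_lipschitz {K : ℝ≥0} {f : A.carrier → B.carrier}
    (h : ∀ (g : G) (x : A.carrier), f (g • x) = g • f x) (hf : LipschitzWith K f) :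
    A.lip B ≤ K := iInf₂_le K ⟨f, h, hf⟩

/-- Strict bounds yield actual maps to compose, whether or not the infimum is attained. -/
theorem lip_lt_mul {C : GTree G} {a b : ℝ≥0∞} (hab : A.lip B < a) (hbc : B.lip C < b) :
    A.lip C < a * b := by
  obtain ⟨K, f, hf, hfK, hK⟩ := exists_lipschitz_of_lip_lt hab
  obtain ⟨K', f', hf', hfK', hK'⟩ := exists_lipschitz_of_lip_lt hbc
  refine (lip_le_of_lipschitz (f := f' ∘ f) (fun g x => by simp [hf, hf'])
    (hfK'.comp hfK)).trans_lt ?_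
  rw [mul_comm K', ENNReal.coe_mul]
  exact ENNReal.mul_lt_mul hK hK'

theorem lip_mul_div_covolume_eq {r : ℝ} (h : A.dLip B = (r : EReal)) :
    A.lip B * (A.covolume / B.covolume) = ENNReal.ofReal (Real.exp r) := by
  rw [← EReal.exp_coe, ← h, dLip, ENNReal.exp_log]

theorem covolume_target_ne_top {r : ℝ} (h : A.dLip B = (r : EReal)) : B.covolume ≠ ∞ := by
  intro htop
  have := lip_mul_div_covolume_eq h
  rw [htop, ENNReal.div_top, mul_zero, eq_comm, ENNReal.ofReal_eq_zero] at this
  exact absurd this (not_le.mpr (Real.exp_pos r))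

theorem covolume_source_ne_zero {r : ℝ} (h : A.dLip B = (r : EReal)) : A.covolume ≠ 0 := by
  intro h0
  have := lip_mul_div_covolume_eq h
  rw [h0, ENNReal.zero_div, mul_zero, eq_comm, ENNReal.ofReal_eq_zero] at this
  exact absurd this (not_le.mpr (Real.exp_pos r))

theorem lip_le_of_source_covolume_eq_one {r : ℝ} (h : A.dLip B = (r : EReal))
    (hA : A.covolume = 1) : A.lip B ≤ ENNReal.ofReal (Real.exp r) * B.covolume := by
  rw [← lip_mul_div_covolume_eq h, hA, one_div, mul_assoc]
  -- If vol(B) = 0 the quotient of volumes is ∞, and finiteness of the product forces Lip(A, B) = 0.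
  by_cases h0 : B.covolume = 0
  · have := lip_mul_div_covolume_eq h
    rw [hA, h0, one_div, ENNReal.inv_zero] at this
    have hl : A.lip B = 0 := by
      by_contra hne
      rw [ENNReal.mul_top hne] at this
      exact ENNReal.ofReal_ne_top this.symm
    simp [hl]
  · rw [ENNReal.inv_mul_cancel h0 (covolume_target_ne_top h), mul_one]

theorem lip_le_of_target_covolume_eq_one {r : ℝ} (h : A.dLip B = (r : EReal))
    (hB : B.covolume = 1) : A.lip B ≤ ENNReal.ofReal (Real.exp r) / A.covolume := by
  rw [← lip_mul_div_covolume_eq h, hB, div_one]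
  refine (ENNReal.le_div_iff_mul_le (Or.inl (covolume_source_ne_zero h)) (Or.inr ?_)).mpr le_rfl
  rw [← div_one A.covolume, ← hB, lip_mul_div_covolume_eq h]
  exact ENNReal.ofReal_ne_top

end GTree

/-! ### Uniform bounds along geodesics -/

/-- Lipschitz distances between compact pieces of geodesics are bounded. -/
theorem exists_lip_le_of_isLipGeodesic {G : Type u} [Group G] (hG : IsGBS G)
    (hsol : ¬ Group.IsSolvable G) {L M : ℝ → DeformationSpace G} (hL : IsLipGeodesic L)
    (hM : IsLipGeodesic M) (a b c d : ℝ) :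
    ∃ D : ℝ, ∀ X Y : CyclicTree G, X.covolume = 1 → Y.covolume = 1 →
      (⟦X⟧ : DeformationSpace G) ∈ L '' Icc a b → (⟦Y⟧ : DeformationSpace G) ∈ M '' Icc c d →
      X.lip Y.toGTree ≤ ENNReal.ofReal D := by
  -- The shifts by 1 place A strictly after every X and B strictly before every Y, as the geodesic
  -- equation requires. The auxiliary trees `A'` and `B'` serve to show vol(A) < ∞ and vol(B) > 0.
  obtain ⟨A, hA⟩ := Quotient.exists_rep (L (b + 1))
  obtain ⟨B, hB⟩ := Quotient.exists_rep (M (c - 1))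
  obtain ⟨A', hA'⟩ := Quotient.exists_rep (L b)
  obtain ⟨B', hB'⟩ := Quotient.exists_rep (M c)
  have hAtop := GTree.covolume_target_ne_top (hL b (b + 1) (by linarith) A' A hA' hA)
  have hB0 := GTree.covolume_source_ne_zero (hM (c - 1) c (by linarith) B B' hB hB')
  obtain ⟨K, f, hf, hfK⟩ := GTree.exists_lipschitz hG.fg hsol A.cyclic A.minimal B.cyclic B.minimal
  let α : ℝ≥0∞ := ENNReal.ofReal (Real.exp (b + 1 - a)) * A.covolume
  let β : ℝ≥0∞ := ENNReal.ofReal (Real.exp (d - (c - 1))) / B.covolume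
  have hα : α ≠ ∞ := ENNReal.mul_ne_top ENNReal.ofReal_ne_top hAtop
  have hβ : β ≠ ∞ := ENNReal.div_ne_top ENNReal.ofReal_ne_top hB0
  have hAB : A.lip B.toGTree < K + 1 :=
    (GTree.lip_le_of_lipschitz hf hfK).trans_lt (ENNReal.lt_add_right ENNReal.coe_ne_top one_ne_zero)
  refine ⟨((α + 1) * ((K + 1) * (β + 1))).toReal, ?_⟩
  rintro X Y hX hY ⟨s, hs, hsX⟩ ⟨t, ht, htY⟩
  rw [ENNReal.ofReal_toReal (ENNReal.mul_ne_top (ENNReal.add_ne_top.mpr ⟨hα, ENNReal.one_ne_top⟩)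
    (ENNReal.mul_ne_top (by simp) (ENNReal.add_ne_top.mpr ⟨hβ, ENNReal.one_ne_top⟩)))]
  have hXA : X.lip A.toGTree ≤ α := by
    refine (GTree.lip_le_of_source_covolume_eq_one
      (hL s (b + 1) (by linarith [hs.2]) X A hsX.symm hA) hX).trans ?_
    have := hs.1
    dsimp only [α]
    gcongr
  have hBY : B.lip Y.toGTree ≤ β := by
    refine (GTree.lip_le_of_target_covolume_eq_one
      (hM (c - 1) t (by linarith [ht.1]) B Y hB htY.symm) hY).trans ?_
    have := ht.2
    dsimp only [β]
    gcongr
  exact (GTree.lip_lt_mul (hXA.trans_lt (ENNReal.lt_add_right hα one_ne_zero))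
    (GTree.lip_lt_mul hAB (hBY.trans_lt (ENNReal.lt_add_right hβ one_ne_zero)))).le

theorem mainTheorem6 {G : Type*} [Group G] (hG : IsGBS G) (hsol : ¬ Group.IsSolvable G)
    (Φ : Out G) (hΦ : FullyIrreducible Φ)
    (T Tm : CyclicTree G) (f : T.carrier → T.carrier) (fm : Tm.carrier → Tm.carrier)
    (lam lamm : ℝ) (hlam : 1 < lam) (hlamm : 1 < lamm)
    (hf : IsTrainTrack Φ T f lam) (hfm : IsTrainTrack Φ⁻¹ Tm fm lamm)
    (L Lm : ℝ → DeformationSpace G) (hL : IsAxis Φ T L) (hLm : IsAxis Φ⁻¹ Tm Lm)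
    (a b c d : ℝ) (hab : a < b) :
    ∃ D : ℝ, 1 < D ∧ ∀ X Y : CyclicTree G,
      X.covolume = 1 → Y.covolume = 1 →
      (⟦X⟧ : DeformationSpace G) ∈ L '' Set.Icc a b ∪ Lm '' Set.Icc c d →
      (⟦Y⟧ : DeformationSpace G) ∈ L '' Set.Icc a b ∪ Lm '' Set.Icc c d →
      X.lip Y.toGTree ≤ ENNReal.ofReal D := by
  obtain ⟨D₁, h₁⟩ := exists_lip_le_of_isLipGeodesic hG hsol hL.geodesic hL.geodesic a b a b
  obtain ⟨D₂, h₂⟩ := exists_lip_le_of_isLipGeodesic hG hsol hL.geodesic hLm.geodesic a b c d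
  obtain ⟨D₃, h₃⟩ := exists_lip_le_of_isLipGeodesic hG hsol hLm.geodesic hL.geodesic c d a b
  obtain ⟨D₄, h₄⟩ := exists_lip_le_of_isLipGeodesic hG hsol hLm.geodesic hLm.geodesic c d c d
  have p₁ := abs_nonneg D₁
  have p₂ := abs_nonneg D₂
  have p₃ := abs_nonneg D₃
  have p₄ := abs_nonneg D₄
  have q₁ := le_abs_self D₁
  have q₂ := le_abs_self D₂
  have q₃ := le_abs_self D₃
  have q₄ := le_abs_self D₄
  -- The summand 2 ensures D > 1; the absolute values make the sum dominate each Dᵢ, whose sign is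
  -- not known.
  refine ⟨2 + |D₁| + |D₂| + |D₃| + |D₄|, ?_, ?_⟩
  · linarith
  rintro X Y hX hY (hXL | hXL) (hYL | hYL)
  · exact (h₁ X Y hX hY hXL hYL).trans (ENNReal.ofReal_le_ofReal (by linarith))
  · exact (h₂ X Y hX hY hXL hYL).trans (ENNReal.ofReal_le_ofReal (by linarith))
  · exact (h₃ X Y hX hY hXL hYL).trans (ENNReal.ofReal_le_ofReal (by linarith))
  · exact (h₄ X Y hX hY hXL hYL).trans (ENNReal.ofReal_le_ofReal (by linarith))
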